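/- Let $n\in\mathbb N$ and let $M_n$ be the algebra of complex $n\times n$ matrices. A linear map $\varphi$ on $M_n$ is called decomposable if $\varphi=\phi_1+\phi_2$ with $\phi_1$ completely positive and $\phi_2$ completely copositive (i.e. $\tau\circ\phi_2$ is completely positive, $\tau$ being the matrix transposition); $\varphi^{*}$ denotes its dual, given by $\operatorname{tr}(A\,\varphi(T))=\operatorname{tr}(\varphi^{*}(A)\,T)$ for all $A,T\in M_n$. Let $\mathcal G$ be a compact Lie group and $U:\mathcal G\to M_n$ a (continuous) unitary representation, with commutant $U(\mathcal G)'=\{X\in M_n: XU(g)=U(g)X\ \text{for all } g\in\mathcal G\}$. A linear map $\varphi$ on $M_n$ is called $U$-covariant if $\varphi(U(g)AU(g)^{-1})=U(g)\varphi(A)U(g)^{-1}$ for all $g\in\mathcal G$, $A\in M_n$; a family of maps is $U$-covariant if each of its members is. Let $(\Lambda_t)_{t\ge 0}$ be a family of trace-preserving linear maps on $M_n$ which is D-divisible, i.e. for all $0\le s\le t$ there is a decomposable map $V_{t,s}$ on $M_n$ with $\Lambda_t=V_{t,s}\circ\Lambda_s$. Assume that $$\frac{d}{dt}\Lambda_t=L_t\circ\Lambda_t\quad\text{for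 every } t\ge 0,\qquad \Lambda_0=\mathrm{id},$$ (with the one-sided derivative at $t=0$), where the generator $L_t$ is regular, i.e. $t\mapsto\|L_t\|$ is bounded on $[0,T]$ for every $T>0$. Then $(\Lambda_t)_{t\ge 0}$ is $U$-covariant if and only if for every $t\ge 0$ there exist a Hermitian matrix $H_t\in U(\mathcal G)'$ and a $U$-covariant decomposable map $\varphi_t$ on $M_n$ such that $$L_t(A)=-i[H_t,A]+\varphi_t(A)-\tfrac12\{\varphi_t^{*}(I),A\}\qquad\text{for all } A\in M_n .$$ -/

import Mathlib

open scoped Matrix Matrix.Norms.L2Operator MatrixOrder ComplexOrder Manifold ContDiff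

noncomputable section

/-- The C*-algebra `M_n` of complex `n × n` matrices, with its spectral norm and Loewner order. -/
abbrev Mat (n : ℕ) : Type := Matrix (Fin n) (Fin n) ℂ

/-- A linear map on `M_n` is completely positive (CP) if all its entrywise amplifications
`M_k(M_n) → M_k(M_n)` are positive. -/
def IsCP {n : ℕ} (φ : Mat n →L[ℂ] Mat n) : Prop :=
  ∃ f : CompletelyPositiveMap (Mat n) (Mat n), ∀ A, f A = φ A

/-- Matrix transposition as a linear map on `M_n`. -/
def transposition (n : ℕ) : Mat n →L[ℂ] Mat n :=
  LinearMap.toContinuousLinearMap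
    (Matrix.transposeLinearEquiv (Fin n) (Fin n) ℂ ℂ : Mat n →ₗ[ℂ] Mat n)

/-- A linear map on `M_n` is completely copositive (coCP) if its composition with the
transposition is CP. -/
def IsCoCP {n : ℕ} (φ : Mat n →L[ℂ] Mat n) : Prop :=
  IsCP ((transposition n).comp φ)

/-- A decomposable map is a sum of a CP map and a coCP map. -/
def IsDecomposable {n : ℕ} (φ : Mat n →L[ℂ] Mat n) : Prop :=
  ∃ φ₁ φ₂ : Mat n →L[ℂ] Mat n, IsCP φ₁ ∧ IsCoCP φ₂ ∧ φ = φ₁ + φ₂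

/-- The dual `φ'` of a map `φ` with respect to the trace pairing; it is characterised by
`tr (A φ(T)) = tr (φ'(A) T)`, see `trace_mul_map_eq`. -/
def traceDual {n : ℕ} (φ : Mat n →L[ℂ] Mat n) (A : Mat n) : Mat n :=
  Matrix.of fun i j => (A * φ (Matrix.single j i 1)).trace

theorem trace_mul_map_eq {n : ℕ} (φ : Mat n →L[ℂ] Mat n) (A T : Mat n) :
    (A * φ T).trace = (traceDual φ A * T).trace := by
  conv_lhs => rw [Matrix.matrix_eq_sum_single T]
  simp only [map_sum, Finset.mul_sum, Matrix.trace_sum]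
  rw [Finset.sum_comm]
  simp only [Matrix.trace, Matrix.diag_apply (traceDual φ A * T),
    Matrix.mul_apply (M := traceDual φ A)]
  refine Finset.sum_congr rfl fun j _ => Finset.sum_congr rfl fun i _ => ?_
  have h : (Matrix.single i j (T i j) : Mat n) = T i j • Matrix.single i j 1 := by
    simp [Matrix.smul_single]
  rw [h, map_smul, mul_smul_comm]
  simp [traceDual, Matrix.trace, Finset.mul_sum, mul_comm]

/-- The family `(Λ_t)_{t ≥ 0}` consists of trace preserving maps. -/
def IsTracePreservingFamily {n : ℕ} (Λ : ℝ → Mat n →L[ℂ] Mat n) : Prop :=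
  ∀ t, 0 ≤ t → ∀ A, (Λ t A).trace = A.trace

/-- The family `(Λ_t)_{t ≥ 0}` is D-divisible: `Λ_t = V_{t,s} ∘ Λ_s` for `0 ≤ s ≤ t` with
decomposable propagators `V_{t,s}`. -/
def IsDDivisible {n : ℕ} (Λ : ℝ → Mat n →L[ℂ] Mat n) : Prop :=
  ∃ V : ℝ → ℝ → Mat n →L[ℂ] Mat n, ∀ s t, 0 ≤ s → s ≤ t →
    Λ t = (V t s).comp (Λ s) ∧ IsDecomposable (V t s)

/-- `(Λ_t)_{t ≥ 0}` solves the Cauchy problem `dΛ_t/dt = L_t ∘ Λ_t`, `Λ_0 = id`, the derivative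
being taken in norm at every `t ≥ 0` (one-sided at `t = 0`). -/
def SolvesMasterEquation {n : ℕ} (Λ L : ℝ → Mat n →L[ℂ] Mat n) : Prop :=
  Λ 0 = ContinuousLinearMap.id ℂ (Mat n) ∧
    ∀ t, 0 ≤ t → HasDerivWithinAt Λ ((L t).comp (Λ t)) (Set.Ici 0) t

/-- The generator is regular: `t ↦ ‖L_t‖` is bounded on every interval `[0, T]`. -/
def IsRegularGenerator {n : ℕ} (L : ℝ → Mat n →L[ℂ] Mat n) : Prop :=
  ∀ T : ℝ, ∃ C : ℝ, ∀ t ∈ Set.Icc 0 T, ‖L t‖ ≤ C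

/-- A map `φ` on `M_n` is `U`-covariant: `φ(U(g) A U(g)⁻¹) = U(g) φ(A) U(g)⁻¹`. -/
def IsCovariant {n : ℕ} {G : Type*} [Group G] (U : G →* Matrix.unitaryGroup (Fin n) ℂ)
    (φ : Mat n →L[ℂ] Mat n) : Prop :=
  ∀ (g : G) (A : Mat n),
    φ ((U g : Mat n) * A * ((U g)⁻¹ : Matrix.unitaryGroup (Fin n) ℂ)) =
      (U g : Mat n) * φ A * ((U g)⁻¹ : Matrix.unitaryGroup (Fin n) ℂ)

/-- The commutant `U(G)′` in `M_n`. -/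
def repCommutant {n : ℕ} {G : Type*} [Group G] (U : G →* Matrix.unitaryGroup (Fin n) ℂ) :
    Set (Mat n) :=
  Set.centralizer (Set.range fun g => (U g : Mat n))

/-- `L = -i[H, ·] + φ - ½{φ'(I), ·}`, where `φ'` is the trace dual of `φ`. -/
def HasGeneratorForm {n : ℕ} (L : Mat n →L[ℂ] Mat n) (H : Mat n) (φ : Mat n →L[ℂ] Mat n) : Prop :=
  ∀ A : Mat n, L A = -Complex.I • (H * A - A * H) + φ A
    - (1 / 2 : ℂ) • (traceDual φ 1 * A + A * traceDual φ 1)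

end

/-! ### Completely positive maps and their Kraus representations -/

/-! Regularity of the generator makes every `Λ t` invertible, so `L t` is the right derivative at
the identity of the decomposable propagators starting at time `t`. The core is the tangent cone of
the decomposable maps at the identity: such a derivative is decomposable up to a map `A ↦ B A + A
Bᴴ` (`exists_eq_decomposable_add_effMap`). Modulo these maps the Kraus operators of the CP part may
be taken traceless, and for `n ≥ 2` a linear functional killing them bounds all Kraus and co-Kraus
operators. The difference quotients thus stay in the sum of a compact set and a subspace, which is
closed and contains the limit.

Preservation of the trace then ties `B + Bᴴ` to the dual of `φ`, leaving a Hermitian `H`. The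
triples `(φ₁, φ₂, H)` representing a covariant `L t` form a nonempty closed convex set stable under
conjugation, and Haar averaging finds a fixed point (`exists_fixedPoint_of_compactGroup`).
Conversely, the generator form with covariant data is covariant, and covariance passes to `Λ t` by
uniqueness for the Cauchy problem. -/

theorem exists_eq_star_mul_self_of_nonneg {A : Type*} [NonUnitalCStarAlgebra A] [PartialOrder A]
    [StarOrderedRing A] {a : A} (ha : 0 ≤ a) : ∃ b, a = star b * b :=
  CStarAlgebra.nonneg_iff_eq_star_mul_self.1 ha

theorem conjTranspose_transpose_conjTranspose {n : ℕ} (K : Mat n) : Kᴴᵀᴴ = Kᵀ := by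
  ext i j
  simp

theorem isCP_iff_forall_map_nonneg {n : ℕ} {φ : Mat n →L[ℂ] Mat n} :
    IsCP φ ↔ ∀ (k : ℕ) (M : CStarMatrix (Fin k) (Fin k) (Mat n)), 0 ≤ M → 0 ≤ M.map φ := by
  constructor
  · rintro ⟨f, hf⟩ k M hM
    have h := f.map_cstarMatrix_nonneg' k M hM
    have hfun : (f.toLinearMap : Mat n → Mat n) = φ := funext hf
    rwa [hfun] at h
  · intro h
    exact ⟨{ (φ : Mat n →ₗ[ℂ] Mat n) with map_cstarMatrix_nonneg' := h }, fun _ => rfl⟩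

theorem isClosed_setOf_isCP (n : ℕ) : IsClosed {φ : Mat n →L[ℂ] Mat n | IsCP φ} := by
  simp only [isCP_iff_forall_map_nonneg, Set.ofPred_forall]
  refine isClosed_iInter fun k => isClosed_iInter fun M => isClosed_iInter fun _ => ?_
  refine (CStarAlgebra.isClosed_nonneg (A := CStarMatrix (Fin k) (Fin k) (Mat n))).preimage
    (f := fun φ : Mat n →L[ℂ] Mat n => M.map φ) ?_
  exact continuous_pi fun i => continuous_pi fun j =>
    (ContinuousLinearMap.apply ℂ (Mat n) (M i j)).continuous

theorem IsCP.zero {n : ℕ} : IsCP (0 : Mat n →L[ℂ] Mat n) := by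
  rw [isCP_iff_forall_map_nonneg]
  intro k M _
  have h : M.map (0 : Mat n →L[ℂ] Mat n) = 0 := by ext i j; simp
  rw [h]

theorem IsCP.add {n : ℕ} {φ ψ : Mat n →L[ℂ] Mat n} (hφ : IsCP φ) (hψ : IsCP ψ) :
    IsCP (φ + ψ) := by
  rw [isCP_iff_forall_map_nonneg] at *
  intro k M hM
  have h : M.map (φ + ψ) = M.map φ + M.map ψ := by ext i j; simp
  rw [h]
  exact add_nonneg (hφ k M hM) (hψ k M hM)

theorem IsCP.sum {n : ℕ} {ι : Type*} {s : Finset ι} {φ : ι → Mat n →L[ℂ] Mat n}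
    (h : ∀ i ∈ s, IsCP (φ i)) : IsCP (∑ i ∈ s, φ i) :=
  Finset.sum_induction _ IsCP (fun _ _ => IsCP.add) IsCP.zero h

/-- The map `X ↦ K X Kᴴ`. -/
noncomputable def conjMap {n : ℕ} (K : Mat n) : Mat n →L[ℂ] Mat n :=
  ContinuousLinearMap.mulLeftRight ℂ (Mat n) K Kᴴ

@[simp]
theorem conjMap_apply {n : ℕ} (K X : Mat n) : conjMap K X = K * X * Kᴴ := rfl

theorem IsCP.conjMap_comp {n : ℕ} {φ : Mat n →L[ℂ] Mat n} (hφ : IsCP φ) (K : Mat n) :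
    IsCP ((conjMap K).comp φ) := by
  rw [isCP_iff_forall_map_nonneg] at *
  intro k M hM
  let D : CStarMatrix (Fin k) (Fin k) (Mat n) :=
    CStarMatrix.ofMatrix (Matrix.diagonal fun _ => K)
  have h : M.map ((conjMap K).comp φ) = D * M.map φ * star D := by
    ext1 i j
    simp [D, CStarMatrix.mul_apply, CStarMatrix.star_apply, Matrix.diagonal_apply,
      Finset.sum_ite_eq, apply_ite, ite_mul, Matrix.star_eq_conjTranspose]
  rw [h]
  exact star_right_conjugate_nonneg (hφ k M hM) D

theorem IsCP.comp_conjMap {n : ℕ} {φ : Mat n →L[ℂ] Mat n} (hφ : IsCP φ) (K : Mat n) :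
    IsCP (φ.comp (conjMap K)) := by
  have hid : IsCP (ContinuousLinearMap.id ℂ (Mat n)) := by
    rw [isCP_iff_forall_map_nonneg]
    exact fun k M hM => hM
  have hK := isCP_iff_forall_map_nonneg.1 (hid.conjMap_comp K)
  rw [isCP_iff_forall_map_nonneg] at *
  exact fun k M hM => hφ k _ (hK k M hM)

theorem isCP_conjMap {n : ℕ} (K : Mat n) : IsCP (conjMap K) := by
  have hid : IsCP (ContinuousLinearMap.id ℂ (Mat n)) := by
    rw [isCP_iff_forall_map_nonneg]
    exact fun k M hM => hM
  exact hid.conjMap_comp K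

theorem IsCP.smul {n : ℕ} {φ : Mat n →L[ℂ] Mat n} (hφ : IsCP φ) {r : ℝ} (hr : 0 ≤ r) :
    IsCP (r • φ) := by
  convert hφ.conjMap_comp (((Real.sqrt r : ℝ) : ℂ) • 1) using 1
  ext1 A
  simp [smul_smul, Real.mul_self_sqrt hr]

theorem convex_setOf_isCP (n : ℕ) : Convex ℝ {φ : Mat n →L[ℂ] Mat n | IsCP φ} :=
  fun _ hφ _ hψ _ _ ha hb _ => (hφ.smul ha).add (hψ.smul hb)

/-- A completely positive map on `M_n` has a Kraus representation with `n²` terms. -/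
theorem IsCP.exists_kraus {n : ℕ} {φ : Mat n →L[ℂ] Mat n} (hφ : IsCP φ) :
    ∃ K : Fin n × Fin n → Mat n, φ = ∑ m, conjMap (K m) := by
  rw [isCP_iff_forall_map_nonneg] at hφ
  -- The image of `E` under the amplified map is the Choi matrix of `φ`. `E` is `n` times a
  -- projection, hence positive.
  let E : CStarMatrix (Fin n) (Fin n) (Mat n) := fun i j => Matrix.single i j 1
  have hEa : ∀ i j, E i j = Matrix.single i j 1 := fun _ _ => rfl
  have hEE : star E * E = n • E := by
    ext1 i j
    rw [CStarMatrix.mul_apply, CStarMatrix.smul_apply]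
    simp [CStarMatrix.star_apply, Matrix.star_eq_conjTranspose, hEa]
  have hE : 0 ≤ E := by
    rcases Nat.eq_zero_or_pos n with rfl | hn
    · exact le_of_eq (Subsingleton.elim _ _)
    · have h : E = star (((Real.sqrt (n : ℝ))⁻¹ : ℝ) • E) * (((Real.sqrt (n : ℝ))⁻¹ : ℝ) • E) := by
        have hn' : (0 : ℝ) < n := by exact_mod_cast hn
        rw [star_smul, smul_mul_smul_comm, hEE, ← Nat.cast_smul_eq_nsmul ℝ, smul_smul]
        simp only [star_trivial]
        rw [← mul_inv, Real.mul_self_sqrt hn'.le, inv_mul_cancel₀ hn'.ne', one_smul]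
      rw [h]
      exact star_mul_self_nonneg _
  obtain ⟨Y, hY⟩ := exists_eq_star_mul_self_of_nonneg (hφ n E hE)
  -- Each scalar row `(p, q)` of the factor `Y` of the Choi matrix, conjugated and reshaped, is one
  -- Kraus operator.
  refine ⟨fun m => Matrix.of fun a i => star (Y m.1 i m.2 a), ?_⟩
  have key : ∀ i j, φ (Matrix.single i j 1) =
      (∑ m : Fin n × Fin n, conjMap (Matrix.of fun a i => star (Y m.1 i m.2 a)))
        (Matrix.single i j 1) := by
    intro i j
    have h := congrFun (congrFun hY i) j
    have h1 : φ (Matrix.single i j 1) = (star Y * Y) i j := h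
    rw [h1]
    ext a b
    simp [CStarMatrix.mul_apply, CStarMatrix.star_apply, Matrix.star_eq_conjTranspose,
      Matrix.mul_apply, Matrix.sum_apply, Fintype.sum_prod_type, Matrix.single_apply,
      Finset.sum_ite_eq, ite_and]
  ext1 A
  rw [Matrix.matrix_eq_sum_single A]
  simp only [map_sum]
  refine Finset.sum_congr rfl fun i _ => Finset.sum_congr rfl fun j _ => ?_
  have hs : (Matrix.single i j (A i j) : Mat n) = A i j • Matrix.single i j 1 := by
    simp [Matrix.smul_single]
  rw [hs, map_smul, map_smul, key]

/-! ### Completely copositive maps -/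

@[simp]
theorem transposition_apply {n : ℕ} (A : Mat n) : transposition n A = Aᵀ := rfl

theorem isClosed_setOf_isCoCP (n : ℕ) : IsClosed {φ : Mat n →L[ℂ] Mat n | IsCoCP φ} :=
  (isClosed_setOf_isCP n).preimage
    ((ContinuousLinearMap.compL ℂ (Mat n) (Mat n) (Mat n) (transposition n)).continuous)

theorem IsCoCP.zero {n : ℕ} : IsCoCP (0 : Mat n →L[ℂ] Mat n) := by
  simpa [IsCoCP] using IsCP.zero (n := n)

theorem convex_setOf_isCoCP (n : ℕ) : Convex ℝ {φ : Mat n →L[ℂ] Mat n | IsCoCP φ} := by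
  intro φ hφ ψ hψ a b ha hb _
  have h : (transposition n).comp (a • φ + b • ψ) =
      a • (transposition n).comp φ + b • (transposition n).comp ψ := by
    ext1 A
    simp
  change IsCP _
  rw [h]
  exact (IsCP.smul hφ ha).add (IsCP.smul hψ hb)

/-- Transposition carries conjugation by `K` to conjugation by the entrywise conjugate `Kᴴᵀ`. -/
theorem IsCoCP.conjMap_comp {n : ℕ} {φ : Mat n →L[ℂ] Mat n} (hφ : IsCoCP φ) (K : Mat n) :
    IsCoCP ((conjMap K).comp φ) := by
  have h : (transposition n).comp ((conjMap K).comp φ) =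
      (conjMap Kᴴᵀ).comp ((transposition n).comp φ) := by
    ext1 A
    simp only [ContinuousLinearMap.comp_apply, conjMap_apply, transposition_apply,
      Matrix.transpose_mul, Matrix.mul_assoc, conjTranspose_transpose_conjTranspose]
  change IsCP _
  rw [h]
  exact IsCP.conjMap_comp hφ _

theorem IsCoCP.comp_conjMap {n : ℕ} {φ : Mat n →L[ℂ] Mat n} (hφ : IsCoCP φ) (K : Mat n) :
    IsCoCP (φ.comp (conjMap K)) :=
  IsCP.comp_conjMap hφ K

/-- The map `X ↦ K Xᵀ Kᴴ`. -/
noncomputable def coconjMap {n : ℕ} (K : Mat n) : Mat n →L[ℂ] Mat n :=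
  (conjMap K).comp (transposition n)

@[simp]
theorem coconjMap_apply {n : ℕ} (K X : Mat n) : coconjMap K X = K * Xᵀ * Kᴴ := rfl

theorem isCoCP_sum_coconjMap {n : ℕ} {ι : Type*} [Fintype ι] (K : ι → Mat n) :
    IsCoCP (∑ m, coconjMap (K m)) := by
  have h : (transposition n).comp (∑ m, coconjMap (K m)) = ∑ m, conjMap (K m)ᴴᵀ := by
    ext1 A
    simp [Matrix.mul_assoc, conjTranspose_transpose_conjTranspose]
  change IsCP _
  rw [h]
  exact IsCP.sum fun m _ => isCP_conjMap _

theorem IsCoCP.exists_kraus {n : ℕ} {φ : Mat n →L[ℂ] Mat n} (hφ : IsCoCP φ) :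
    ∃ K : Fin n × Fin n → Mat n, φ = ∑ m, coconjMap (K m) := by
  obtain ⟨K, hK⟩ := IsCP.exists_kraus hφ
  refine ⟨fun m => (K m)ᴴᵀ, ?_⟩
  ext1 A
  have h := congrArg (fun ψ => (ψ A)ᵀ) hK
  simp only [ContinuousLinearMap.comp_apply, transposition_apply, Matrix.transpose_transpose] at h
  rw [h]
  simp [Matrix.transpose_sum, Matrix.mul_assoc, conjTranspose_transpose_conjTranspose]

/-! ### The tangent cone of the decomposable maps at the identity -/

/-- The map `B ↦ (A ↦ B A + A Bᴴ)`. -/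
noncomputable def effMap (n : ℕ) : Mat n →ₗ[ℝ] (Mat n →L[ℂ] Mat n) where
  toFun B := ContinuousLinearMap.mulLeftRight ℂ (Mat n) B 1 +
    ContinuousLinearMap.mulLeftRight ℂ (Mat n) 1 Bᴴ
  map_add' B C := by
    ext1 A
    simp only [ContinuousLinearMap.mulLeftRight_apply, _root_.add_apply, Matrix.conjTranspose_add,
      add_mul, mul_add, one_mul, mul_one]
    abel
  map_smul' r B := by
    ext1 A
    simp [Matrix.conjTranspose_smul]

@[simp]
theorem effMap_apply {n : ℕ} (B A : Mat n) : effMap n B A = B * A + A * Bᴴ := by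
  simp [effMap]

/-- A functional that annihilates the maps `A ↦ B A + A Bᴴ` and is positive on decomposable
maps. -/
noncomputable def coneFunctional (n : ℕ) : (Mat n →L[ℂ] Mat n) →ₗ[ℂ] ℂ where
  toFun ψ := (ψ 1).trace - (1 / n : ℂ) * ∑ i, ∑ j, ψ (Matrix.single i j 1) i j
  map_add' φ ψ := by
    simp only [_root_.add_apply, Matrix.trace_add, Matrix.add_apply,
      Finset.sum_add_distrib]
    ring
  map_smul' c ψ := by
    simp only [_root_.smul_apply, Matrix.trace_smul, Matrix.smul_apply, smul_eq_mul,
      RingHom.id_apply, ← Finset.mul_sum]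
    ring

theorem coneFunctional_apply {n : ℕ} (ψ : Mat n →L[ℂ] Mat n) : coneFunctional n ψ =
    (ψ 1).trace - (1 / n : ℂ) * ∑ i, ∑ j, ψ (Matrix.single i j 1) i j := rfl

theorem continuous_coneFunctional (n : ℕ) : Continuous (coneFunctional n) :=
  LinearMap.continuous_of_finiteDimensional _

/-- The double sum equals `n (tr B + tr Bᴴ)`; the weight `1 / n` is chosen to cancel it against the
first term. -/
theorem coneFunctional_effMap {n : ℕ} (hn : n ≠ 0) (B : Mat n) :
    coneFunctional n (effMap n B) = 0 := by
  have hn' : (n : ℂ) ≠ 0 := by exact_mod_cast hn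
  simp [coneFunctional_apply, Matrix.mul_apply, Matrix.single_apply, Finset.sum_add_distrib,
    Matrix.trace, Matrix.add_apply, ← Finset.mul_sum]
  field_simp
  ring

/-- The squared Hilbert–Schmidt norm. -/
def hsSq {n : ℕ} (K : Mat n) : ℝ := ∑ i, ∑ j, Complex.normSq (K i j)

theorem hsSq_nonneg {n : ℕ} (K : Mat n) : 0 ≤ hsSq K :=
  Finset.sum_nonneg fun _ _ => Finset.sum_nonneg fun _ _ => Complex.normSq_nonneg _

theorem trace_mul_conjTranspose_eq_hsSq {n : ℕ} (K : Mat n) : (K * Kᴴ).trace = hsSq K := by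
  simp [hsSq, Matrix.trace, Matrix.mul_apply, Complex.normSq_eq_conj_mul_self, mul_comm]

/-- The double sum is `|tr K|²`, so it drops out for traceless `K`. -/
theorem coneFunctional_conjMap {n : ℕ} {K : Mat n} (hK : K.trace = 0) :
    coneFunctional n (conjMap K) = hsSq K := by
  have h : ∑ i, ∑ j, conjMap K (Matrix.single i j 1) i j = K.trace * star K.trace := by
    simp [Matrix.trace, Matrix.mul_apply, Matrix.single_apply, ite_and, Finset.sum_mul_sum]
  rw [coneFunctional_apply, h, hK]
  simp [trace_mul_conjTranspose_eq_hsSq]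

/-- Here the double sum is `∑ N i j * star (N j i)`, controlled by the arithmetic-geometric mean
inequality; no trace condition on `N` is required. -/
theorem le_coneFunctional_coconjMap {n : ℕ} (N : Mat n) :
    (1 - 1 / (n : ℝ)) * hsSq N ≤ (coneFunctional n (coconjMap N)).re := by
  have h : (∑ i, ∑ j, coconjMap N (Matrix.single i j 1) i j).re ≤ hsSq N := by
    have h1 : ∀ i j, (coconjMap N (Matrix.single i j 1) i j).re ≤
        (Complex.normSq (N i j) + Complex.normSq (N j i)) / 2 := by
      intro i j
      have h2 : coconjMap N (Matrix.single i j 1) i j = N i j * star (N j i) := by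
        simp [Matrix.mul_apply, Matrix.single_apply, ite_and]
      rw [h2]
      simp only [Complex.normSq_apply, Complex.star_def, Complex.mul_re, Complex.conj_re,
        Complex.conj_im]
      nlinarith [sq_nonneg ((N i j).re - (N j i).re), sq_nonneg ((N i j).im - (N j i).im)]
    have h3 : hsSq N = ∑ i, ∑ j, (Complex.normSq (N i j) + Complex.normSq (N j i)) / 2 := by
      simp only [← Finset.sum_div, Finset.sum_add_distrib]
      rw [Finset.sum_comm (f := fun i j => Complex.normSq (N j i))]
      simp [hsSq]
    rw [h3, Complex.re_sum]
    refine Finset.sum_le_sum fun i _ => ?_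
    rw [Complex.re_sum]
    exact Finset.sum_le_sum fun j _ => h1 i j
  have hc : (1 / n : ℂ) = ((1 / (n : ℝ) : ℝ) : ℂ) := by push_cast; rfl
  rw [coneFunctional_apply, Complex.sub_re, hc, Complex.re_ofReal_mul]
  have h1 : (coconjMap N 1).trace = hsSq N := by
    simp [trace_mul_conjTranspose_eq_hsSq]
  rw [h1, Complex.ofReal_re]
  have hn : (0 : ℝ) ≤ 1 / n := by positivity
  nlinarith

/-- The decomposable map with Kraus operators `κ₁` and co-Kraus operators `κ₂`, given by
coordinates. -/
noncomputable def krausDecomposable (n : ℕ)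
    (κ : (Fin n × Fin n → Fin n → Fin n → ℂ) × (Fin n × Fin n → Fin n → Fin n → ℂ)) :
    (Mat n →L[ℂ] Mat n) × (Mat n →L[ℂ] Mat n) :=
  (∑ m, conjMap (Matrix.of (κ.1 m)), ∑ m, coconjMap (Matrix.of (κ.2 m)))

theorem continuous_conjMap (n : ℕ) : Continuous (conjMap : Mat n → Mat n →L[ℂ] Mat n) :=
  (((ContinuousLinearMap.mulLeftRight ℂ (Mat n)).continuous).clm_apply
    (Continuous.matrix_conjTranspose continuous_id))

theorem continuous_krausDecomposable (n : ℕ) : Continuous (krausDecomposable n) := by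
  have h : ∀ m, Continuous fun κ : (Fin n × Fin n → Fin n → Fin n → ℂ) =>
      conjMap (Matrix.of (κ m)) := fun m =>
    (continuous_conjMap n).comp (continuous_apply m)
  refine Continuous.prodMk ?_ ?_
  · exact continuous_finsetSum _ fun m _ => (h m).comp continuous_fst
  · exact continuous_finsetSum _ fun m _ =>
      (((h m).comp continuous_snd).clm_comp continuous_const)

/-- Write `K = K' + c • 1` with `c = tr K / n` and expand: `B` absorbs the cross terms and, in two
equal halves, the term `|c|² A`. -/
theorem exists_conjMap_eq_add_effMap {n : ℕ} (hn : n ≠ 0) (K : Mat n) :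
    ∃ K' B : Mat n, K'.trace = 0 ∧ conjMap K = conjMap K' + effMap n B := by
  have hn' : (n : ℂ) ≠ 0 := by exact_mod_cast hn
  set c : ℂ := K.trace / n with hc
  refine ⟨K - c • 1, star c • (K - c • 1) + (c * star c / 2) • 1, ?_, ?_⟩
  · simp [hc, hn']
  · ext1 A
    have h2 : star (c * star c / 2) = c * star c / 2 := by simp [mul_comm]
    simp only [_root_.add_apply, conjMap_apply, effMap_apply,
      Matrix.conjTranspose_add, Matrix.conjTranspose_sub, Matrix.conjTranspose_smul,
      Matrix.conjTranspose_one, star_star, h2]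
    simp only [add_mul, sub_mul, mul_add, mul_sub, smul_mul_assoc, mul_smul_comm, one_mul,
      mul_one, smul_sub, smul_smul]
    module

theorem IsCoCP.smul {n : ℕ} {φ : Mat n →L[ℂ] Mat n} (hφ : IsCoCP φ) {r : ℝ} (hr : 0 ≤ r) :
    IsCoCP (r • φ) := by
  have h : (transposition n).comp (r • φ) = r • (transposition n).comp φ := by
    ext1 A
    simp
  change IsCP _
  rw [h]
  exact IsCP.smul hφ hr

theorem IsDecomposable.smul {n : ℕ} {φ : Mat n →L[ℂ] Mat n} (hφ : IsDecomposable φ) {r : ℝ}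
    (hr : 0 ≤ r) : IsDecomposable (r • φ) := by
  obtain ⟨φ₁, φ₂, h₁, h₂, rfl⟩ := hφ
  exact ⟨r • φ₁, r • φ₂, h₁.smul hr, h₂.smul hr, smul_add _ _ _⟩

/-- A decomposable map has Kraus operators of which those of its completely positive part are
traceless, up to a map of the form `A ↦ B A + A Bᴴ`. -/
theorem IsDecomposable.exists_traceless_kraus {n : ℕ} (hn : n ≠ 0) {φ : Mat n →L[ℂ] Mat n}
    (hφ : IsDecomposable φ) : ∃ (K N : Fin n × Fin n → Mat n) (B : Mat n),
      (∀ m, (K m).trace = 0) ∧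
        φ = ∑ m, conjMap (K m) + ∑ m, coconjMap (N m) + effMap n B := by
  obtain ⟨φ₁, φ₂, h₁, h₂, rfl⟩ := hφ
  obtain ⟨K, rfl⟩ := h₁.exists_kraus
  obtain ⟨N, rfl⟩ := h₂.exists_kraus
  choose K' B hK' hKB using fun m => exists_conjMap_eq_add_effMap hn (K m)
  refine ⟨K', N, ∑ m, B m, hK', ?_⟩
  simp only [hKB, Finset.sum_add_distrib, map_sum]
  abel

theorem norm_entry_sq_le_hsSq {n : ℕ} (K : Mat n) (i j : Fin n) : ‖K i j‖ ^ 2 ≤ hsSq K := by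
  rw [← Complex.normSq_eq_norm_sq]
  calc Complex.normSq (K i j) ≤ ∑ j, Complex.normSq (K i j) :=
        Finset.single_le_sum (f := fun j => Complex.normSq (K i j))
          (fun _ _ => Complex.normSq_nonneg _) (Finset.mem_univ j)
    _ ≤ hsSq K := Finset.single_le_sum (f := fun i => ∑ j, Complex.normSq (K i j))
          (fun _ _ => Finset.sum_nonneg fun _ _ => Complex.normSq_nonneg _) (Finset.mem_univ i)

/-- The coercivity estimate behind compactness: `n ≥ 2` gives `1 - 1 / n ≥ 1 / 2`, and `B` is
invisible to the functional. -/
theorem sum_hsSq_le_coneFunctional {n : ℕ} (hn : 2 ≤ n) {K N : Fin n × Fin n → Mat n} (B : Mat n)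
    (hK : ∀ m, (K m).trace = 0) :
    (∑ m, hsSq (K m) + ∑ m, hsSq (N m)) / 2 ≤
      (coneFunctional n (∑ m, conjMap (K m) + ∑ m, coconjMap (N m) + effMap n B)).re := by
  have hn' : (2 : ℝ) ≤ n := by exact_mod_cast hn
  have h1 : 1 / (n : ℝ) ≤ 1 / 2 := one_div_le_one_div_of_le two_pos hn'
  rw [map_add, map_add, map_sum, map_sum, coneFunctional_effMap (by omega), add_zero,
    Complex.add_re, Complex.re_sum, Complex.re_sum, add_div, Finset.sum_div, Finset.sum_div]
  refine add_le_add (Finset.sum_le_sum fun m _ => ?_) (Finset.sum_le_sum fun m _ => ?_)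
  · rw [coneFunctional_conjMap (hK m), Complex.ofReal_re]
    linarith [hsSq_nonneg (K m)]
  · refine le_trans ?_ (le_coneFunctional_coconjMap (N m))
    nlinarith [hsSq_nonneg (N m)]

open scoped Pointwise in
/-- The right derivative at the identity of a curve of decomposable maps is a decomposable map up
to a map of the form `A ↦ B A + A Bᴴ`. -/
theorem exists_eq_decomposable_add_effMap {n : ℕ} (hn : 2 ≤ n) {D : ℝ → Mat n →L[ℂ] Mat n}
    {L : Mat n →L[ℂ] Mat n} (hD : ∀ h, 0 < h → IsDecomposable (D h))
    (hL : Filter.Tendsto (fun h : ℝ => h⁻¹ • (D h - ContinuousLinearMap.id ℂ (Mat n)))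
      (nhdsWithin 0 (Set.Ioi 0)) (nhds L)) :
    ∃ (φ₁ φ₂ : Mat n →L[ℂ] Mat n) (B : Mat n), IsCP φ₁ ∧ IsCoCP φ₂ ∧
      L = φ₁ + φ₂ + effMap n B := by
  have hn0 : n ≠ 0 := by omega
  set R : ℝ := ‖coneFunctional n L‖ + 1 with hR
  have hF : ∀ᶠ h in nhdsWithin (0 : ℝ) (Set.Ioi 0),
      (coneFunctional n (h⁻¹ • (D h - ContinuousLinearMap.id ℂ (Mat n)))).re < R := by
    have ht := (Complex.continuous_re.tendsto _).comp
      (((continuous_coneFunctional n).tendsto L).comp hL)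
    refine ht.eventually_lt_const ?_
    linarith [Complex.re_le_norm (coneFunctional n L)]
  -- The ball is in the sup norm of the Kraus coordinates. Its radius comes from `hsSq ≤ 2 * R` and
  -- `x ≤ x ^ 2 + 1`.
  set T : Set (Mat n →L[ℂ] Mat n) := (fun κ => (krausDecomposable n κ).1 +
    (krausDecomposable n κ).2) '' Metric.closedBall 0 (2 * R + 1) with hT
  have hTc : IsCompact T := by
    refine (isCompact_closedBall _ _).image ?_
    exact ((continuous_krausDecomposable n).fst).add ((continuous_krausDecomposable n).snd)
  have hW : IsClosed (LinearMap.range (effMap n) : Set (Mat n →L[ℂ] Mat n)) :=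
    Submodule.closed_of_finiteDimensional _
  have hTW := hW.add_left_of_isCompact hTc
  -- The identity lies in the range of `effMap`, so subtracting it, even divided by a small `h`,
  -- changes only `B`.
  have hid : ContinuousLinearMap.id ℂ (Mat n) = effMap n ((1 / 2 : ℂ) • 1) := by
    ext1 A
    simp only [ContinuousLinearMap.id_apply, effMap_apply, Matrix.conjTranspose_smul,
      Matrix.conjTranspose_one, smul_mul_assoc, mul_smul_comm, one_mul, mul_one]
    have h2 : star (1 / 2 : ℂ) = 1 / 2 := by simp
    rw [h2]
    module
  have hmem : ∀ᶠ h in nhdsWithin (0 : ℝ) (Set.Ioi 0),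
      h⁻¹ • (D h - ContinuousLinearMap.id ℂ (Mat n)) ∈
        T + (LinearMap.range (effMap n) : Set (Mat n →L[ℂ] Mat n)) := by
    filter_upwards [hF, self_mem_nhdsWithin] with h hFh hpos
    obtain ⟨K, N, B, hK, hKN⟩ :=
      ((hD h hpos).smul (inv_nonneg.2 (le_of_lt hpos))).exists_traceless_kraus hn0
    have hform : h⁻¹ • (D h - ContinuousLinearMap.id ℂ (Mat n)) =
        ∑ m, conjMap (K m) + ∑ m, coconjMap (N m) +
          effMap n (B - h⁻¹ • ((1 / 2 : ℂ) • 1)) := by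
      rw [smul_sub, hKN, map_sub, map_smul, ← hid]
      abel
    rw [hform] at hFh ⊢
    have hle := (sum_hsSq_le_coneFunctional hn (B - h⁻¹ • ((1 / 2 : ℂ) • 1)) (N := N) hK).trans
      hFh.le
    have hKm : ∀ m, hsSq (K m) ≤ 2 * R := fun m => by
      have h1 := Finset.single_le_sum (f := fun m => hsSq (K m)) (fun _ _ => hsSq_nonneg _)
        (Finset.mem_univ m)
      have h2 : 0 ≤ ∑ m, hsSq (N m) := Finset.sum_nonneg fun _ _ => hsSq_nonneg _
      linarith
    have hNm : ∀ m, hsSq (N m) ≤ 2 * R := fun m => by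
      have h1 := Finset.single_le_sum (f := fun m => hsSq (N m)) (fun _ _ => hsSq_nonneg _)
        (Finset.mem_univ m)
      have h2 : 0 ≤ ∑ m, hsSq (K m) := Finset.sum_nonneg fun _ _ => hsSq_nonneg _
      linarith
    have hR0 : (0 : ℝ) ≤ 2 * R + 1 := by positivity
    have hentry : ∀ (X : Mat n), hsSq X ≤ 2 * R → ∀ i j, ‖X i j‖ ≤ 2 * R + 1 := by
      intro X hX i j
      have h1 := norm_entry_sq_le_hsSq X i j
      nlinarith [norm_nonneg (X i j)]
    refine Set.add_mem_add ⟨(K, N), ?_, rfl⟩ ⟨_, rfl⟩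
    rw [mem_closedBall_zero_iff, Prod.norm_def]
    refine max_le ?_ ?_ <;>
    · refine (pi_norm_le_iff_of_nonneg hR0).2 fun m => ?_
      refine (pi_norm_le_iff_of_nonneg hR0).2 fun i => ?_
      refine (pi_norm_le_iff_of_nonneg hR0).2 fun j => ?_
      first
      | exact hentry (K m) (hKm m) i j
      | exact hentry (N m) (hNm m) i j
  obtain ⟨_, ⟨κ, _, rfl⟩, _, ⟨B, rfl⟩, hL'⟩ := hTW.mem_of_tendsto hL hmem
  exact ⟨_, _, B, IsCP.sum fun m _ => isCP_conjMap _, isCoCP_sum_coconjMap _, hL'.symm⟩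

/-! ### Trace annihilation and the Hamiltonian -/

theorem eq_zero_of_trace_mul_eq_zero {n : ℕ} {X : Mat n} (h : ∀ A : Mat n, (X * A).trace = 0) :
    X = 0 := by
  have h1 := h Xᴴ
  exact Matrix.trace_mul_conjTranspose_self_eq_zero_iff.1 h1

/-- A trace annihilating generator in the form `φ + B · + · Bᴴ` can be rewritten with a Hermitian
Hamiltonian. -/
theorem exists_hasGeneratorForm_of_effMap {n : ℕ} {L φ : Mat n →L[ℂ] Mat n} {B : Mat n}
    (htr : ∀ A, (L A).trace = 0) (hL : L = φ + effMap n B) :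
    ∃ H : Mat n, H.IsHermitian ∧ HasGeneratorForm L H φ := by
  have hd : traceDual φ 1 = -(B + Bᴴ) := by
    rw [eq_neg_iff_add_eq_zero]
    refine eq_zero_of_trace_mul_eq_zero fun A => ?_
    have h1 := htr A
    have h2 := trace_mul_map_eq φ 1 A
    rw [one_mul] at h2
    rw [hL, _root_.add_apply, effMap_apply, Matrix.trace_add, Matrix.trace_add, h2,
      Matrix.trace_mul_comm A] at h1
    rw [add_mul, add_mul, Matrix.trace_add, Matrix.trace_add, ← h1]
  -- With this choice `-i H` is the skew-Hermitian part of `B`; by `hd` the Hermitian part is the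
  -- anticommutator term.
  refine ⟨(Complex.I / 2) • (B - Bᴴ), ?_, fun A => ?_⟩
  · have hI : star (Complex.I / 2) = -(Complex.I / 2) := by
      simp [neg_div]
    rw [Matrix.IsHermitian, Matrix.conjTranspose_smul, hI, Matrix.conjTranspose_sub,
      Matrix.conjTranspose_conjTranspose, neg_smul, ← smul_neg, neg_sub]
  · have hI : -Complex.I * (Complex.I / 2) = 1 / 2 := by
      rw [neg_mul, ← mul_div_assoc, Complex.I_mul_I]; norm_num
    rw [hd, hL, _root_.add_apply, effMap_apply, smul_mul_assoc, mul_smul_comm, ← smul_sub,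
      smul_smul, hI]
    simp only [sub_mul, mul_sub, neg_mul, mul_neg, add_mul, mul_add]
    module

/-- Settles the sizes excluded from the coercivity estimate, where a matrix is determined by its
trace. -/
theorem eq_zero_of_trace_eq_zero_of_le_one {n : ℕ} (hn : n ≤ 1) {L : Mat n →L[ℂ] Mat n}
    (htr : ∀ A, (L A).trace = 0) : L = 0 := by
  have : Subsingleton (Fin n) := Fin.subsingleton_iff_le_one.2 hn
  ext A i j
  have h := htr A
  rw [Matrix.trace, Fintype.sum_subsingleton _ i] at h
  rw [Subsingleton.elim j i]
  simpa using h

/-! ### The dynamics -/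

theorem SolvesMasterEquation.hasDerivWithinAt_apply {n : ℕ} {Λ L : ℝ → Mat n →L[ℂ] Mat n}
    (hode : SolvesMasterEquation Λ L) {t : ℝ} (ht : 0 ≤ t) (A : Mat n) :
    HasDerivWithinAt (fun s => Λ s A) (L t (Λ t A)) (Set.Ici 0) t :=
  ((ContinuousLinearMap.apply ℂ (Mat n) A).restrictScalars ℝ).hasFDerivAt.comp_hasDerivWithinAt t
    (hode.2 t ht)

theorem IsRegularGenerator.exists_lipschitzOnWith {n : ℕ} {L : ℝ → Mat n →L[ℂ] Mat n}
    (hreg : IsRegularGenerator L) (T : ℝ) :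
    ∃ K : NNReal, ∀ t ∈ Set.Icc 0 T, LipschitzOnWith K (L t) Set.univ := by
  obtain ⟨C, hC⟩ := hreg T
  refine ⟨C.toNNReal, fun t ht => ((L t).lipschitz.weaken ?_).lipschitzOnWith⟩
  rw [← NNReal.coe_le_coe]
  exact (hC t ht).trans (Real.le_coe_toNNReal C)

/-- Backward uniqueness: orbits that meet at time `t` agree at time `0`. A uniform Lipschitz bound
suffices, without continuity of `L` in time. -/
theorem SolvesMasterEquation.injective {n : ℕ} {Λ L : ℝ → Mat n →L[ℂ] Mat n}
    (hode : SolvesMasterEquation Λ L) (hreg : IsRegularGenerator L) {t : ℝ} (ht : 0 ≤ t) :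
    Function.Injective (Λ t) := by
  obtain ⟨K, hK⟩ := hreg.exists_lipschitzOnWith t
  intro A B hAB
  have hc : ∀ A : Mat n, ContinuousOn (fun s => Λ s A) (Set.Icc 0 t) := fun A s hs =>
    (hode.hasDerivWithinAt_apply hs.1 A).continuousWithinAt.mono Set.Icc_subset_Ici_self
  have hd : ∀ A : Mat n, ∀ s ∈ Set.Ioc 0 t,
      HasDerivWithinAt (fun s => Λ s A) (L s (Λ s A)) (Set.Iic s) s := fun A s hs =>
    ((hode.hasDerivWithinAt_apply hs.1.le A).hasDerivAt (Ici_mem_nhds hs.1)).hasDerivWithinAt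
  have h := ODE_solution_unique_of_mem_Icc_left (v := fun s => L s) (s := fun _ => Set.univ)
    (fun s hs => hK s ⟨hs.1.le, hs.2⟩) (hc A) (hd A) (fun _ _ => trivial) (hc B) (hd B)
    (fun _ _ => trivial) hAB (Set.left_mem_Icc.2 ht)
  simpa [hode.1] using h

theorem SolvesMasterEquation.surjective {n : ℕ} {Λ L : ℝ → Mat n →L[ℂ] Mat n}
    (hode : SolvesMasterEquation Λ L) (hreg : IsRegularGenerator L) {t : ℝ} (ht : 0 ≤ t) :
    Function.Surjective (Λ t) :=
  (LinearMap.injective_iff_surjective (f := (Λ t : Mat n →ₗ[ℂ] Mat n))).1 (hode.injective hreg ht)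

theorem tendsto_smul_sub_of_hasDerivWithinAt_Ici {F : Type*} [NormedAddCommGroup F]
    [NormedSpace ℝ F] {f : ℝ → F} {f' : F} {t : ℝ} (ht : 0 ≤ t)
    (hf : HasDerivWithinAt f f' (Set.Ici 0) t) :
    Filter.Tendsto (fun h : ℝ => h⁻¹ • (f (t + h) - f t)) (nhdsWithin 0 (Set.Ioi 0))
      (nhds f') := by
  have h1 := (hasDerivWithinAt_iff_tendsto_slope' (lt_irrefl t)).1
    (hf.mono (Set.Ioi_subset_Ici ht))
  have h2 : Filter.Tendsto (fun h : ℝ => t + h) (nhdsWithin 0 (Set.Ioi 0))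
      (nhdsWithin t (Set.Ioi t)) := by
    refine tendsto_nhdsWithin_iff.2 ⟨?_, ?_⟩
    · have h3 : Filter.Tendsto (fun h : ℝ => t + h) (nhds 0) (nhds (t + 0)) :=
        (continuous_const_add t).tendsto 0
      rw [add_zero] at h3
      exact h3.mono_left nhdsWithin_le_nhds
    · filter_upwards [self_mem_nhdsWithin] with h hh
      exact lt_add_of_pos_right t hh
  refine (h1.comp h2).congr fun h => ?_
  simp [slope]

/-- The generator at time `t` is the right derivative of the propagators starting at time `t`. -/
theorem SolvesMasterEquation.tendsto_propagator {n : ℕ} {Λ L : ℝ → Mat n →L[ℂ] Mat n}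
    (hode : SolvesMasterEquation Λ L) (hreg : IsRegularGenerator L) {t : ℝ} (ht : 0 ≤ t)
    {V : ℝ → Mat n →L[ℂ] Mat n} (hV : ∀ h, 0 < h → Λ (t + h) = (V h).comp (Λ t)) :
    Filter.Tendsto (fun h : ℝ => h⁻¹ • (V h - ContinuousLinearMap.id ℂ (Mat n)))
      (nhdsWithin 0 (Set.Ioi 0)) (nhds (L t)) := by
  -- Inverting `Λ t` on the right turns the difference quotient of `Λ` into that of the propagator.
  let e := LinearEquiv.ofInjectiveEndo (Λ t : Mat n →ₗ[ℂ] Mat n) (hode.injective hreg ht)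
  let Γ : Mat n →L[ℂ] Mat n := LinearMap.toContinuousLinearMap (e.symm : Mat n →ₗ[ℂ] Mat n)
  have hΓ : (Λ t).comp Γ = ContinuousLinearMap.id ℂ (Mat n) := by
    ext1 A
    exact e.apply_symm_apply A
  have h1 := tendsto_smul_sub_of_hasDerivWithinAt_Ici (F := Mat n →L[ℂ] Mat n) ht (hode.2 t ht)
  have h2 := (((ContinuousLinearMap.compL ℂ (Mat n) (Mat n) (Mat n)).flip Γ).continuous.tendsto
    _).comp h1
  have h3 : ((ContinuousLinearMap.compL ℂ (Mat n) (Mat n) (Mat n)).flip Γ) ((L t).comp (Λ t)) =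
      L t := by
    simp only [ContinuousLinearMap.flip_apply, ContinuousLinearMap.compL_apply,
      ContinuousLinearMap.comp_assoc, hΓ, ContinuousLinearMap.comp_id]
  rw [h3] at h2
  refine h2.congr' ?_
  filter_upwards [self_mem_nhdsWithin] with h hh
  simp only [Function.comp_apply, ContinuousLinearMap.flip_apply, ContinuousLinearMap.compL_apply, hV h hh, ContinuousLinearMap.smul_comp,
    ContinuousLinearMap.sub_comp, ContinuousLinearMap.comp_assoc, hΓ,
    ContinuousLinearMap.comp_id]

/-- Every `A` is some `Λ t B`, and the trace is constant along the orbit of `B`. -/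
theorem SolvesMasterEquation.trace_generator {n : ℕ} {Λ L : ℝ → Mat n →L[ℂ] Mat n}
    (hode : SolvesMasterEquation Λ L) (hreg : IsRegularGenerator L)
    (htp : IsTracePreservingFamily Λ) {t : ℝ} (ht : 0 ≤ t) (A : Mat n) :
    (L t A).trace = 0 := by
  obtain ⟨B, rfl⟩ := hode.surjective hreg ht A
  have h1 := ((LinearMap.toContinuousLinearMap
    (Matrix.traceLinearMap (Fin n) ℂ ℂ)).restrictScalars ℝ).hasFDerivAt.comp_hasDerivWithinAt t
      (hode.hasDerivWithinAt_apply ht B)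
  have h2 : HasDerivWithinAt (fun s => (Λ s B).trace) 0 (Set.Ici 0) t :=
    (hasDerivWithinAt_const t (Set.Ici 0) B.trace).congr (fun s hs => htp s hs B) (htp t ht B)
  exact (uniqueDiffOn_Ici (0 : ℝ) t ht).eq_deriv _ h1 h2

/-! ### Covariance -/

/-- Conjugation by `U g`, as a linear map on `M_n`. -/
noncomputable def repConj {n : ℕ} {G : Type*} [Group G]
    (U : G →* Matrix.unitaryGroup (Fin n) ℂ) (g : G) : Mat n →L[ℂ] Mat n :=
  conjMap (U g : Mat n)

section
variable {n : ℕ} {G : Type*} [Group G] (U : G →* Matrix.unitaryGroup (Fin n) ℂ)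

theorem isCovariant_iff {φ : Mat n →L[ℂ] Mat n} :
    IsCovariant U φ ↔ ∀ g A, φ (repConj U g A) = repConj U g (φ A) := Iff.rfl

theorem repConj_apply (g : G) (A : Mat n) : repConj U g A = U g * A * (U g : Mat n)ᴴ := rfl

theorem conjTranspose_mul_rep (g : G) : (U g : Mat n)ᴴ * (U g : Mat n) = 1 :=
  Matrix.mem_unitaryGroup_iff'.1 (U g).2

theorem rep_mul_conjTranspose (g : G) : (U g : Mat n) * (U g : Mat n)ᴴ = 1 :=
  Matrix.mem_unitaryGroup_iff.1 (U g).2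

theorem repConj_mul (g h : G) (A : Mat n) :
    repConj U (g * h) A = repConj U g (repConj U h A) := by
  simp [repConj_apply, Matrix.mul_assoc]

@[simp]
theorem repConj_one (A : Mat n) : repConj U 1 A = A := by
  simp [repConj_apply]

@[simp]
theorem repConj_inv_apply_self (g : G) (A : Mat n) : repConj U g⁻¹ (repConj U g A) = A := by
  rw [← repConj_mul, inv_mul_cancel, repConj_one]

@[simp]
theorem repConj_apply_inv_self (g : G) (A : Mat n) : repConj U g (repConj U g⁻¹ A) = A := by
  rw [← repConj_mul, mul_inv_cancel, repConj_one]

theorem repConj_mul_matrix (g : G) (A B : Mat n) :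
    repConj U g (A * B) = repConj U g A * repConj U g B := by
  simp only [repConj_apply, Matrix.mul_assoc]
  rw [← Matrix.mul_assoc (U g : Mat n)ᴴ (U g : Mat n), conjTranspose_mul_rep, Matrix.one_mul]

@[simp]
theorem trace_repConj (g : G) (A : Mat n) : (repConj U g A).trace = A.trace := by
  rw [repConj_apply, Matrix.trace_mul_comm, ← Matrix.mul_assoc, conjTranspose_mul_rep,
    Matrix.one_mul]

theorem isHermitian_repConj (g : G) {H : Mat n} (hH : H.IsHermitian) :
    (repConj U g H).IsHermitian := by
  rw [repConj_apply]
  exact Matrix.isHermitian_mul_mul_conjTranspose _ hH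

theorem mem_repCommutant_of_repConj_eq {H : Mat n} (h : ∀ g, repConj U g H = H) :
    H ∈ repCommutant U := by
  rw [repCommutant, Set.mem_centralizer_iff]
  rintro _ ⟨g, rfl⟩
  conv_rhs => rw [← h g]
  rw [repConj_apply, Matrix.mul_assoc, conjTranspose_mul_rep, Matrix.mul_one]

theorem repConj_eq_of_mem_repCommutant {H : Mat n} (h : H ∈ repCommutant U) (g : G) :
    repConj U g H = H := by
  rw [repCommutant, Set.mem_centralizer_iff] at h
  rw [repConj_apply, h _ ⟨g, rfl⟩, Matrix.mul_assoc, rep_mul_conjTranspose, Matrix.mul_one]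

/-- Conjugation of a map on `M_n` by the conjugation with `U g`. -/
noncomputable def mapConj (g : G) : (Mat n →L[ℂ] Mat n) →ₗ[ℝ] (Mat n →L[ℂ] Mat n) where
  toFun φ := (repConj U g).comp (φ.comp (repConj U g⁻¹))
  map_add' φ ψ := by ext1 A; simp
  map_smul' r φ := by ext1 A; simp

@[simp]
theorem mapConj_apply (g : G) (φ : Mat n →L[ℂ] Mat n) (A : Mat n) :
    mapConj U g φ A = repConj U g (φ (repConj U g⁻¹ A)) := rfl

theorem isCovariant_iff_mapConj_eq {φ : Mat n →L[ℂ] Mat n} :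
    IsCovariant U φ ↔ ∀ g, mapConj U g φ = φ := by
  rw [isCovariant_iff]
  refine forall_congr' fun g => ⟨fun h => ?_, fun h A => ?_⟩
  · ext1 A
    rw [mapConj_apply, ← h, repConj_apply_inv_self]
  · conv_lhs => rw [← h]
    rw [mapConj_apply, repConj_inv_apply_self]

theorem IsCP.mapConj {φ : Mat n →L[ℂ] Mat n} (hφ : IsCP φ) (g : G) : IsCP (mapConj U g φ) :=
  (hφ.comp_conjMap _).conjMap_comp _

theorem IsCoCP.mapConj {φ : Mat n →L[ℂ] Mat n} (hφ : IsCoCP φ) (g : G) :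
    IsCoCP (mapConj U g φ) :=
  (hφ.comp_conjMap _).conjMap_comp _

/-- Unitary conjugation preserves the trace pairing and fixes the identity matrix. -/
theorem traceDual_mapConj (φ : Mat n →L[ℂ] Mat n) (g : G) :
    traceDual (mapConj U g φ) 1 = repConj U g (traceDual φ 1) := by
  rw [← sub_eq_zero]
  refine eq_zero_of_trace_mul_eq_zero fun A => ?_
  rw [sub_mul, Matrix.trace_sub, ← trace_mul_map_eq, one_mul, mapConj_apply, trace_repConj,
    ← one_mul (φ _), trace_mul_map_eq]
  nth_rewrite 2 [← repConj_apply_inv_self U g A]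
  rw [← repConj_mul_matrix, trace_repConj, sub_self]

theorem HasGeneratorForm.mapConj {L φ : Mat n →L[ℂ] Mat n} {H : Mat n}
    (h : HasGeneratorForm L H φ) (g : G) :
    HasGeneratorForm (mapConj U g L) (repConj U g H) (mapConj U g φ) := by
  intro A
  rw [mapConj_apply, h, traceDual_mapConj]
  simp only [map_add, map_sub, map_smul, repConj_mul_matrix, repConj_apply_inv_self, mapConj_apply]

theorem HasGeneratorForm.isCovariant {L φ : Mat n →L[ℂ] Mat n} {H : Mat n}
    (h : HasGeneratorForm L H φ) (hH : H ∈ repCommutant U) (hφ : IsCovariant U φ) :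
    IsCovariant U L := by
  rw [isCovariant_iff_mapConj_eq] at hφ ⊢
  intro g
  ext1 A
  rw [h.mapConj U g A, hφ, repConj_eq_of_mem_repCommutant U hH, h A]

end

/-- Covariant generators generate covariant evolutions. -/
theorem SolvesMasterEquation.isCovariant {n : ℕ} {G : Type*} [Group G]
    (U : G →* Matrix.unitaryGroup (Fin n) ℂ) {Λ L : ℝ → Mat n →L[ℂ] Mat n}
    (hode : SolvesMasterEquation Λ L) (hreg : IsRegularGenerator L)
    (hL : ∀ t, 0 ≤ t → IsCovariant U (L t)) {t : ℝ} (ht : 0 ≤ t) : IsCovariant U (Λ t) := by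
  rw [isCovariant_iff]
  intro g A
  obtain ⟨K, hK⟩ := hreg.exists_lipschitzOnWith t
  have hd : ∀ s, 0 ≤ s → HasDerivWithinAt (fun s => repConj U g (Λ s A))
      (L s (repConj U g (Λ s A))) (Set.Ici 0) s := fun s hs => by
    rw [(isCovariant_iff U).1 (hL s hs)]
    exact ((repConj U g).restrictScalars ℝ).hasFDerivAt.comp_hasDerivWithinAt s
      (hode.hasDerivWithinAt_apply hs A)
  have hd' := fun s (hs : 0 ≤ s) => hode.hasDerivWithinAt_apply hs (repConj U g A)
  refine ODE_solution_unique_of_mem_Icc_right (v := fun s => L s) (s := fun _ => Set.univ)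
    (fun s hs => hK s ⟨hs.1, hs.2.le⟩)
    (fun s hs => (hd' s hs.1).continuousWithinAt.mono Set.Icc_subset_Ici_self)
    (fun s hs => (hd' s hs.1).mono (Set.Ici_subset_Ici.2 hs.1)) (fun _ _ => trivial)
    (fun s hs => (hd s hs.1).continuousWithinAt.mono Set.Icc_subset_Ici_self)
    (fun s hs => (hd s hs.1).mono (Set.Ici_subset_Ici.2 hs.1)) (fun _ _ => trivial)
    ?_ (Set.right_mem_Icc.2 ht)
  simp [hode.1]

/-- Covariant evolutions have covariant generators. -/
theorem SolvesMasterEquation.isCovariant_generator {n : ℕ} {G : Type*} [Group G]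
    (U : G →* Matrix.unitaryGroup (Fin n) ℂ) {Λ L : ℝ → Mat n →L[ℂ] Mat n}
    (hode : SolvesMasterEquation Λ L) (hreg : IsRegularGenerator L)
    (hΛ : ∀ t, 0 ≤ t → IsCovariant U (Λ t)) {t : ℝ} (ht : 0 ≤ t) : IsCovariant U (L t) := by
  rw [isCovariant_iff]
  intro g A
  obtain ⟨B, rfl⟩ := hode.surjective hreg ht A
  have h1 := hode.hasDerivWithinAt_apply ht (repConj U g B)
  have h2 := ((repConj U g).restrictScalars ℝ).hasFDerivAt.comp_hasDerivWithinAt t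
      (hode.hasDerivWithinAt_apply ht B)
  have hcov := fun s (hs : 0 ≤ s) => (isCovariant_iff U).1 (hΛ s hs) g B
  rw [← hcov t ht]
  exact (uniqueDiffOn_Ici (0 : ℝ) t ht).eq_deriv _ h1 (h2.congr hcov (hcov t ht))

/-! ### Averaging over a compact group -/

/-- A nonempty closed convex set invariant under a continuous linear action of a compact group
contains a fixed point. -/
theorem exists_fixedPoint_of_compactGroup {G : Type*} [Group G] [TopologicalSpace G]
    [IsTopologicalGroup G] [CompactSpace G] {W : Type*} [NormedAddCommGroup W] [NormedSpace ℝ W]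
    [FiniteDimensional ℝ W] (ρ : G → W →ₗ[ℝ] W)
    (hmul : ∀ g h x, ρ (g * h) x = ρ g (ρ h x)) (hcont : ∀ x, Continuous fun g => ρ g x)
    {S : Set W} (hconv : Convex ℝ S) (hclosed : IsClosed S) (hne : S.Nonempty)
    (hinv : ∀ g, ∀ x ∈ S, ρ g x ∈ S) : ∃ x ∈ S, ∀ g, ρ g x = x := by
  borelize G
  obtain ⟨x, hx⟩ := hne
  have : CompleteSpace W := FiniteDimensional.complete ℝ W
  -- Taking the whole group as reference compact set gives Haar measure total mass one, so the
  -- average stays in `S`.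
  let K : TopologicalSpace.PositiveCompacts G := ⊤
  let μ := MeasureTheory.Measure.haarMeasure K
  have hμ : MeasureTheory.IsProbabilityMeasure μ :=
    ⟨MeasureTheory.Measure.haarMeasure_self (K₀ := K)⟩
  have hint : MeasureTheory.Integrable (fun g => ρ g x) μ :=
    (hcont x).integrable_of_hasCompactSupport (HasCompactSupport.of_compactSpace _)
  refine ⟨∫ g, ρ g x ∂μ, hconv.integral_mem hclosed (.of_forall fun g => hinv g x hx) hint,
    fun g => ?_⟩
  have h := (LinearMap.toContinuousLinearMap (ρ g)).integral_comp_comm hint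
  calc ρ g (∫ h, ρ h x ∂μ) = ∫ h, ρ g (ρ h x) ∂μ := h.symm
    _ = ∫ h, ρ (g * h) x ∂μ := by simp only [hmul]
    _ = ∫ h, ρ h x ∂μ := MeasureTheory.integral_mul_left_eq_self (fun h => ρ h x) g

/-! ### The conjugation action on triples -/

section
variable {n : ℕ} {G : Type*} [Group G] (U : G →* Matrix.unitaryGroup (Fin n) ℂ)

/-- The action of `g` on triples `(φ₁, φ₂, H)` by conjugation. -/
noncomputable def tripleConj (g : G) :
    ((Mat n →L[ℂ] Mat n) × (Mat n →L[ℂ] Mat n) × Mat n) →ₗ[ℝ]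
      ((Mat n →L[ℂ] Mat n) × (Mat n →L[ℂ] Mat n) × Mat n) :=
  (mapConj U g).prodMap ((mapConj U g).prodMap
    ((repConj U g : Mat n →ₗ[ℂ] Mat n).restrictScalars ℝ))

@[simp]
theorem tripleConj_apply (g : G) (x : (Mat n →L[ℂ] Mat n) × (Mat n →L[ℂ] Mat n) × Mat n) :
    tripleConj U g x = (mapConj U g x.1, mapConj U g x.2.1, repConj U g x.2.2) := rfl

theorem mapConj_mul (g h : G) (φ : Mat n →L[ℂ] Mat n) :
    mapConj U (g * h) φ = mapConj U g (mapConj U h φ) := by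
  ext1 A
  simp only [mapConj_apply, mul_inv_rev, repConj_mul]

theorem tripleConj_mul (g h : G) (x : (Mat n →L[ℂ] Mat n) × (Mat n →L[ℂ] Mat n) × Mat n) :
    tripleConj U (g * h) x = tripleConj U g (tripleConj U h x) :=
  Prod.ext (mapConj_mul U g h x.1)
    (Prod.ext (mapConj_mul U g h x.2.1) (repConj_mul U g h x.2.2))

variable [TopologicalSpace G] {U}

theorem continuous_repConj (hU : Continuous U) : Continuous (repConj U) :=
  (continuous_conjMap n).comp (continuous_subtype_val.comp hU)

theorem continuous_mapConj [ContinuousInv G] (hU : Continuous U) (φ : Mat n →L[ℂ] Mat n) :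
    Continuous fun g => mapConj U g φ :=
  (continuous_repConj hU).clm_comp
    (continuous_const.clm_comp ((continuous_repConj hU).comp continuous_inv))

theorem continuous_tripleConj [ContinuousInv G] (hU : Continuous U)
    (x : (Mat n →L[ℂ] Mat n) × (Mat n →L[ℂ] Mat n) × Mat n) :
    Continuous fun g => tripleConj U g x := by
  have h : Continuous fun g => repConj U g x.2.2 :=
    (continuous_repConj hU).clm_apply continuous_const
  exact (continuous_mapConj hU x.1).prodMk ((continuous_mapConj hU x.2.1).prodMk h)

end

/-! ### The closed convex set of generator data -/

/-- The triples `(φ₁, φ₂, H)` with `φ₁` CP, `φ₂` coCP and `H` Hermitian that represent `L` in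
generator form. -/
def generatorTriples {n : ℕ} (L : Mat n →L[ℂ] Mat n) :
    Set ((Mat n →L[ℂ] Mat n) × (Mat n →L[ℂ] Mat n) × Mat n) :=
  {x | IsCP x.1 ∧ IsCoCP x.2.1 ∧ x.2.2.IsHermitian ∧ HasGeneratorForm L x.2.2 (x.1 + x.2.1)}

theorem mem_generatorTriples {n : ℕ} {L φ₁ φ₂ : Mat n →L[ℂ] Mat n} {H : Mat n} :
    (φ₁, φ₂, H) ∈ generatorTriples L ↔
      IsCP φ₁ ∧ IsCoCP φ₂ ∧ H.IsHermitian ∧ HasGeneratorForm L H (φ₁ + φ₂) := Iff.rfl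

theorem traceDual_add {n : ℕ} (φ ψ : Mat n →L[ℂ] Mat n) (A : Mat n) :
    traceDual (φ + ψ) A = traceDual φ A + traceDual ψ A := by
  ext i j
  simp [traceDual, mul_add]

theorem traceDual_smul {n : ℕ} (r : ℝ) (φ : Mat n →L[ℂ] Mat n) (A : Mat n) :
    traceDual (r • φ) A = r • traceDual φ A := by
  ext i j
  simp [traceDual]

/-- The value at `A` of the generator given by a triple `(φ₁, φ₂, H)`. -/
noncomputable def generatorValue {n : ℕ} (A : Mat n) :
    ((Mat n →L[ℂ] Mat n) × (Mat n →L[ℂ] Mat n) × Mat n) →ₗ[ℝ] Mat n where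
  toFun x := -Complex.I • (x.2.2 * A - A * x.2.2) + (x.1 + x.2.1) A
    - (1 / 2 : ℂ) • (traceDual (x.1 + x.2.1) 1 * A + A * traceDual (x.1 + x.2.1) 1)
  map_add' x y := by
    simp only [Prod.fst_add, Prod.snd_add, traceDual_add, _root_.add_apply, add_mul, mul_add]
    module
  map_smul' r x := by
    simp only [Prod.smul_fst, Prod.smul_snd, traceDual_add, traceDual_smul, _root_.add_apply,
      _root_.smul_apply, add_mul, mul_add, smul_mul_assoc, mul_smul_comm, RingHom.id_apply]
    module

/-- Splits membership into one condition per component and linear equations, so that closedness and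
convexity follow factor by factor. Keeping `φ₁` and `φ₂` apart avoids proving that the sum of the
two cones is closed. -/
theorem generatorTriples_eq {n : ℕ} (L : Mat n →L[ℂ] Mat n) : generatorTriples L =
    (Prod.fst ⁻¹' {φ | IsCP φ}) ∩ ((fun x => x.2.1) ⁻¹' {φ | IsCoCP φ}) ∩
      ((fun x => x.2.2) ⁻¹' {H | Hᴴ = H}) ∩ ⋂ A, generatorValue A ⁻¹' {L A} := by
  ext x
  simp only [generatorTriples, HasGeneratorForm, Matrix.IsHermitian, Set.mem_inter_iff,
    Set.mem_preimage, Set.mem_iInter, Set.mem_singleton_iff, Set.mem_ofPred_eq, and_assoc,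
    eq_comm (a := L _)]
  rfl

theorem isClosed_generatorTriples {n : ℕ} (L : Mat n →L[ℂ] Mat n) :
    IsClosed (generatorTriples L) := by
  rw [generatorTriples_eq]
  refine ((((isClosed_setOf_isCP n).preimage continuous_fst).inter
    ((isClosed_setOf_isCoCP n).preimage (continuous_fst.comp continuous_snd))).inter
    (IsClosed.preimage (continuous_snd.comp continuous_snd) ?_)).inter
    (isClosed_iInter fun A => isClosed_singleton.preimage ?_)
  · exact isClosed_eq (Continuous.matrix_conjTranspose continuous_id) continuous_id
  · exact LinearMap.continuous_of_finiteDimensional _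

theorem convex_generatorTriples {n : ℕ} (L : Mat n →L[ℂ] Mat n) :
    Convex ℝ (generatorTriples L) := by
  rw [generatorTriples_eq]
  refine ((((convex_setOf_isCP n).linear_preimage (LinearMap.fst ℝ _ _)).inter
    ((convex_setOf_isCoCP n).linear_preimage (LinearMap.fst ℝ _ _ ∘ₗ LinearMap.snd ℝ _ _))).inter
    (Convex.linear_preimage ?_ (LinearMap.snd ℝ _ _ ∘ₗ LinearMap.snd ℝ _ _))).inter
    (convex_iInter fun A => (convex_singleton _).linear_preimage _)
  intro H hH K hK a b _ _ _
  simp only [Set.mem_ofPred_eq] at hH hK ⊢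
  rw [Matrix.conjTranspose_add, Matrix.conjTranspose_smul, Matrix.conjTranspose_smul, hH, hK]
  simp

theorem tripleConj_mem_generatorTriples {n : ℕ} {G : Type*} [Group G]
    (U : G →* Matrix.unitaryGroup (Fin n) ℂ) {L : Mat n →L[ℂ] Mat n} (hL : IsCovariant U L) (g : G)
    (x : (Mat n →L[ℂ] Mat n) × (Mat n →L[ℂ] Mat n) × Mat n) (hx : x ∈ generatorTriples L) :
    tripleConj U g x ∈ generatorTriples L := by
  obtain ⟨φ₁, φ₂, H⟩ := x
  rw [mem_generatorTriples] at hx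
  have h := hx.2.2.2.mapConj U g
  rw [(isCovariant_iff_mapConj_eq U).1 hL, map_add] at h
  rw [tripleConj_apply, mem_generatorTriples]
  exact ⟨hx.1.mapConj U g, hx.2.1.mapConj U g, isHermitian_repConj U g hx.2.2.1, h⟩

/-- A covariant generator that has a generator form has a covariant one. -/
theorem exists_covariant_generatorForm {n : ℕ} {G : Type*} [Group G] [TopologicalSpace G]
    [IsTopologicalGroup G] [CompactSpace G] {U : G →* Matrix.unitaryGroup (Fin n) ℂ}
    (hU : Continuous U) {L : Mat n →L[ℂ] Mat n} (hL : IsCovariant U L)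
    (hne : (generatorTriples L).Nonempty) : ∃ (H : Mat n) (φ : Mat n →L[ℂ] Mat n),
      H.IsHermitian ∧ H ∈ repCommutant U ∧ IsDecomposable φ ∧ IsCovariant U φ ∧
        HasGeneratorForm L H φ := by
  obtain ⟨x, ⟨h₁, h₂, hH, hform⟩, hfix⟩ := exists_fixedPoint_of_compactGroup (tripleConj U)
    (tripleConj_mul U) (continuous_tripleConj hU) (convex_generatorTriples L)
    (isClosed_generatorTriples L) hne (tripleConj_mem_generatorTriples U hL)
  have hfix₁ : ∀ g, mapConj U g x.1 = x.1 := fun g => congrArg Prod.fst (hfix g)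
  have hfix₂ : ∀ g, mapConj U g x.2.1 = x.2.1 := fun g => congrArg (fun y => y.2.1) (hfix g)
  have hfix₃ : ∀ g, repConj U g x.2.2 = x.2.2 := fun g => congrArg (fun y => y.2.2) (hfix g)
  refine ⟨x.2.2, x.1 + x.2.1, hH, mem_repCommutant_of_repConj_eq U hfix₃,
    ⟨_, _, h₁, h₂, rfl⟩, (isCovariant_iff_mapConj_eq U).2 fun g => ?_, hform⟩
  rw [map_add, hfix₁, hfix₂]

/-- The generators of a D-divisible trace preserving evolution have a generator form. -/
theorem SolvesMasterEquation.nonempty_generatorTriples {n : ℕ} {Λ L : ℝ → Mat n →L[ℂ] Mat n}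
    (hode : SolvesMasterEquation Λ L) (hreg : IsRegularGenerator L) (hdiv : IsDDivisible Λ)
    (htp : IsTracePreservingFamily Λ) {t : ℝ} (ht : 0 ≤ t) : (generatorTriples (L t)).Nonempty := by
  have htr := hode.trace_generator hreg htp ht
  rcases Nat.lt_or_ge 1 n with hn | hn
  · obtain ⟨V, hV⟩ := hdiv
    have hV' := fun h (hh : 0 < h) => hV t (t + h) ht (le_add_of_nonneg_right (le_of_lt hh))
    obtain ⟨φ₁, φ₂, B, h₁, h₂, hL⟩ := exists_eq_decomposable_add_effMap hn
      (D := fun h => V (t + h) t) (fun h hh => (hV' h hh).2)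
      (hode.tendsto_propagator hreg ht fun h hh => (hV' h hh).1)
    obtain ⟨H, hH, hform⟩ := exists_hasGeneratorForm_of_effMap htr hL
    exact ⟨(φ₁, φ₂, H), h₁, h₂, hH, hform⟩
  -- For `n ≤ 1` the generator vanishes, and the zero triple represents it.
  · refine ⟨0, IsCP.zero, IsCoCP.zero, Matrix.isHermitian_zero, fun A => ?_⟩
    rw [eq_zero_of_trace_eq_zero_of_le_one hn htr]
    exact (map_zero (generatorValue A)).symm

theorem mainTheorem8 {n : ℕ}
    {E : Type*} [NormedAddCommGroup E] [NormedSpace ℝ E] [FiniteDimensional ℝ E]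
    {G : Type*} [Group G] [TopologicalSpace G] [ChartedSpace E G] [LieGroup 𝓘(ℝ, E) ∞ G]
    [T2Space G] [CompactSpace G]
    (U : G →* Matrix.unitaryGroup (Fin n) ℂ) (hU : Continuous U)
    (Λ L : ℝ → Mat n →L[ℂ] Mat n)
    (hdiv : IsDDivisible Λ) (htp : IsTracePreservingFamily Λ)
    (hode : SolvesMasterEquation Λ L) (hreg : IsRegularGenerator L) :
    (∀ t, 0 ≤ t → IsCovariant U (Λ t)) ↔
      ∀ t, 0 ≤ t → ∃ (H : Mat n) (φ : Mat n →L[ℂ] Mat n),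
        H.IsHermitian ∧ H ∈ repCommutant U ∧ IsDecomposable φ ∧ IsCovariant U φ ∧
          HasGeneratorForm (L t) H φ := by
  have : IsTopologicalGroup G := topologicalGroup_of_lieGroup 𝓘(ℝ, E) ∞
  constructor
  · intro hΛ t ht
    exact exists_covariant_generatorForm hU (hode.isCovariant_generator U hreg hΛ ht)
      (hode.nonempty_generatorTriples hreg hdiv htp ht)
  · intro h t ht
    refine hode.isCovariant U hreg (fun s hs => ?_) ht
    obtain ⟨H, φ, _, hH, _, hφ, hform⟩ := h s hs
    exact hform.isCovariant U hH hφ
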